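/- Let $D\subseteq\mathbb{C}$ be a domain (an open path-connected set), let $H(D)$ be the ring of holomorphic functions on $D$ with pointwise operations, and let $M$ be a maximal ideal of $H(D)$ that is free, i.e. $\bigcap_{f\in M}\{z\in D: f(z)=0\}=\emptyset$. Let $ki(M):=\bigcap_{n=1}^\infty M^n$. For $q\in H(D)$, $q\not\equiv 0$, let $\mathbf{o}(q)\in\{0,1,2,\dots\}\cup\{\infty\}$ be the supremum of the orders of the zeros of $q$ in $D$ (with $\mathbf{o}(q)=0$ if $q$ has no zeros), and set $\mathbf{o}(0):=\infty$. Then $$ ki(M)=\Big\{f\in M : \text{whenever } f=q\cdot d \text{ with } q\in H(D) \text{ and } d\in H(D)\setminus M,\ \text{we have } \mathbf{o}(q)=\infty\Big\}. $$ Moreover, $ki(M)$ is the largest nonmaximal prime ideal of $H(D)$ contained in $M$; that is, $ki(M)$ is a nonmaximal prime ideal contained in $M$, and every nonmaximal prime ideal $P\subseteq M$ of $H(D)$ satisfies $P\subseteq ki(M)$. -/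

import Mathlib

/-- The algebra `H(D)` of holomorphic functions on `D`, with pointwise operations: the functions
`f : D → ℂ` that are the restriction to `D` of a function that is complex differentiable on `D`. -/
def holomorphicAlgebra (D : Set ℂ) : Subalgebra ℂ (D → ℂ) where
  carrier := {f | ∃ F : ℂ → ℂ, DifferentiableOn ℂ F D ∧ ∀ z : D, F z = f z}
  mul_mem' := by
    rintro f g ⟨F, hF, hFf⟩ ⟨G, hG, hGg⟩
    exact ⟨F * G, hF.mul hG, fun z => by simp [hFf, hGg]⟩
  add_mem' := by
    rintro f g ⟨F, hF, hFf⟩ ⟨G, hG, hGg⟩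
    exact ⟨F + G, hF.add hG, fun z => by simp [hFf, hGg]⟩
  algebraMap_mem' := fun c => ⟨fun _ => c, differentiableOn_const c, fun _ => rfl⟩

/-- The zero set `Z_D(f)` of a holomorphic function on `D`. -/
def holomorphicZeros {D : Set ℂ} (f : holomorphicAlgebra D) : Set D :=
  {z | f.1 z = 0}

/-- An ideal of `H(D)` is free if its elements have no common zero in `D`. -/
def IsFreeIdeal {D : Set ℂ} (I : Ideal (holomorphicAlgebra D)) : Prop :=
  ⋂ f ∈ I, holomorphicZeros f = ∅

/-- The order `ord(f, ζ)` of `f` at the point `ζ` of the (open) set `D`. The function `f` is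
extended by zero outside `D`, which does not matter near a point of the open set `D`. -/
noncomputable def zeroOrder {D : Set ℂ} (f : holomorphicAlgebra D) (ζ : D) : ℕ∞ :=
  analyticOrderAt (Function.extend Subtype.val f.1 0) (ζ : ℂ)

open Classical in
/-- The supremum `𝐨(f)` of the orders of the zeros of `f` in `D`, with `𝐨(0) = ∞`. The supremum
is taken in `ℕ∞`; it is `0` if `f` has no zeros. -/
noncomputable def supZeroOrder {D : Set ℂ} (f : holomorphicAlgebra D) : ℕ∞ :=
  if f = 0 then ⊤ else ⨆ ζ ∈ holomorphicZeros f, zeroOrder f ζ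

/-- The Krull intersection `ki(I) = ⋂_{n ≥ 1} Iⁿ` of an ideal. -/
def krullIntersection {R : Type*} [CommRing R] (I : Ideal R) : Ideal R :=
  ⨅ (n : ℕ) (_ : 1 ≤ n), I ^ n

open Filter Topology in
/-- A holomorphic function on the unit disc is uniformly approximated on the closed disc of radius
`1/2` by entire functions. -/
theorem exists_entire_norm_sub_le_of_differentiableOn_ball {F : ℂ → ℂ}
    (hF : DifferentiableOn ℂ F (Metric.ball 0 1)) {ε : ℝ} (hε : 0 < ε) :
    ∃ Q : ℂ → ℂ, Differentiable ℂ Q ∧ ∀ w, ‖w‖ ≤ 1 / 2 → ‖F w - Q w‖ ≤ ε := by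
  have h1 : DifferentiableOn ℂ F (Metric.closedBall 0 ((3 / 4 : NNReal) : ℝ)) :=
    hF.mono (Metric.closedBall_subset_ball (by norm_num [NNReal.coe_div]))
  have h2 := h1.hasFPowerSeriesOnBall (by positivity)
  have h3 := h2.tendstoUniformlyOn (r' := 5 / 8) (by
    norm_cast
    rw [← NNReal.coe_lt_coe]
    push_cast
    norm_num)
  rw [Metric.tendstoUniformlyOn_iff] at h3
  obtain ⟨n, hn⟩ := (h3 ε hε).exists
  refine ⟨fun w => (cauchyPowerSeries F 0 (3 / 4 : NNReal)).partialSum n w, ?_, ?_⟩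
  · simp only [FormalMultilinearSeries.partialSum, FormalMultilinearSeries.apply_eq_pow_smul_coeff]
    fun_prop
  · intro w hw
    have := hn w (by
      rw [Metric.mem_ball, dist_zero_right]
      refine lt_of_le_of_lt hw ?_
      push_cast
      norm_num)
    rw [zero_add, dist_eq_norm] at this
    exact this.le

/-- Every point `a` of an open set `D` has a holomorphic parameter `w a` on `D` that takes the value
`1` exactly at `a`, to first order, and is small on a given compact set for `a` near the boundary
of `D`. -/
theorem IsOpen.exists_holomorphic_parameter {D : Set ℂ} (hD : IsOpen D) :
    ∃ w : ℂ → ℂ → ℂ, (∀ a ∈ D, DifferentiableOn ℂ (w a) D ∧ (∀ z ∈ D, w a z = 1 ↔ z = a) ∧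
      deriv (w a) a ≠ 0) ∧ ∀ K ⊆ D, IsCompact K → ∃ K' ⊆ D, IsCompact K' ∧
        ∀ a ∈ D, a ∉ K' → ∀ z ∈ K, ‖w a z‖ ≤ 1 / 2 := by
  classical
  rcases eq_or_ne D Set.univ with rfl | hne
  · refine ⟨fun a z => if a = 0 then z + 1 else z / a, ?_, ?_⟩
    · intro a _
      by_cases ha : a = 0
      · subst ha
        simp only [if_true]
        refine ⟨by fun_prop, fun z _ => by simp, by simp⟩
      · simp only [ha, if_false]
        refine ⟨by fun_prop, fun z _ => div_eq_one_iff_eq ha, ?_⟩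
        simp [ha]
    · intro K _ hK
      obtain ⟨R, hR, hKR⟩ := hK.isBounded.exists_pos_norm_le
      refine ⟨Metric.closedBall 0 (2 * R), Set.subset_univ _, isCompact_closedBall _ _, ?_⟩
      intro a _ ha z hz
      rw [Metric.mem_closedBall, dist_zero_right, not_le] at ha
      have ha0 : a ≠ 0 := by
        rintro rfl
        simp at ha
        linarith
      simp only [ha0, if_false, norm_div]
      rw [div_le_iff₀ (by linarith)]
      linarith [hKR z hz]
  have hcne : Dᶜ.Nonempty := Set.nonempty_compl.mpr hne
  have hc : IsClosed Dᶜ := hD.isClosed_compl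
  choose b hb hbd using fun a : ℂ => hc.exists_infDist_eq_dist hcne a
  set δ : ℂ → ℝ := fun a => Metric.infDist a Dᶜ with hδ
  have hδcont : Continuous δ := Metric.continuous_infDist_pt _
  have hδpos : ∀ a ∈ D, 0 < δ a := fun a ha =>
    (hc.notMem_iff_infDist_pos hcne).mp (by simpa using ha)
  have hDδ : ∀ a, 0 < δ a → a ∈ D := fun a ha => by
    simpa using (hc.notMem_iff_infDist_pos hcne).mpr ha
  have hcomp : ∀ r s : ℝ, 0 < s → {a : ℂ | ‖a‖ ≤ r ∧ s ≤ δ a} ⊆ D ∧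
      IsCompact {a : ℂ | ‖a‖ ≤ r ∧ s ≤ δ a} := by
    intro r s hs
    refine ⟨fun a ha => hDδ a (hs.trans_le ha.2), ?_⟩
    refine (isCompact_closedBall (0 : ℂ) r).of_isClosed_subset
      ((isClosed_le continuous_norm continuous_const).inter
        (isClosed_le continuous_const hδcont)) fun a ha => by simpa using ha.1
  refine ⟨fun a z => if 1 ≤ ‖a‖ * δ a then z / a else (a - b a) / (z - b a), ?_, ?_⟩
  · intro a haD
    by_cases h : 1 ≤ ‖a‖ * δ a
    · have ha : a ≠ 0 := by
        rintro rfl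
        norm_num at h
      simp only [h, if_true]
      refine ⟨by fun_prop, fun z _ => div_eq_one_iff_eq ha, ?_⟩
      simp [ha]
    · simp only [h, if_false]
      have hzb : ∀ z ∈ D, z - b a ≠ 0 := fun z hz h0 => hb a (sub_eq_zero.mp h0 ▸ hz)
      refine ⟨?_, ?_, ?_⟩
      · exact (differentiableOn_const _).div (by fun_prop) hzb
      · intro z hz
        rw [div_eq_one_iff_eq (hzb z hz)]
        constructor
        · intro h
          linear_combination -h
        · rintro rfl
          rfl
      · have h1 : HasDerivAt (fun z => (a - b a) / (z - b a))
            ((0 * (a - b a) - (a - b a) * 1) / (a - b a) ^ 2) a :=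
          (hasDerivAt_const a (a - b a)).div ((hasDerivAt_id a).sub_const (b a)) (hzb a haD)
        rw [h1.deriv]
        rw [zero_mul, mul_one, zero_sub]
        exact div_ne_zero (neg_ne_zero.mpr (hzb a haD)) (pow_ne_zero _ (hzb a haD))
  · intro K hKD hK
    obtain ⟨R, hR, hKR⟩ := hK.isBounded.exists_pos_norm_le
    obtain ⟨ρ, hρ, hKρ⟩ : ∃ ρ > 0, ∀ z ∈ K, ρ ≤ δ z := by
      rcases K.eq_empty_or_nonempty with rfl | hKne
      · exact ⟨1, one_pos, by simp⟩
      · obtain ⟨z, hz, hzm⟩ := hK.exists_isMinOn hKne hδcont.continuousOn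
        exact ⟨δ z, hδpos z (hKD hz), fun y hy => hzm hy⟩
    have h1 := hcomp (2 * R) (1 / (2 * R)) (by positivity)
    have h2 := hcomp (2 / ρ) (ρ / 2) (by positivity)
    refine ⟨_, Set.union_subset h1.1 h2.1, h1.2.union h2.2, ?_⟩
    intro a haD ha z hz
    have hδa := hδpos a haD
    simp only [Set.mem_union, Set.mem_ofPred_eq, not_or, not_and, not_le] at ha
    by_cases h : 1 ≤ ‖a‖ * δ a
    · simp only [h, if_true, norm_div]
      have h3 : 2 * R ≤ ‖a‖ := by
        by_contra! h4
        have h5 := ha.1 h4.le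
        rw [lt_div_iff₀ (by positivity)] at h5
        nlinarith
      rw [div_le_iff₀ (by linarith)]
      linarith [hKR z hz]
    · simp only [h, if_false, norm_div]
      have h3 : δ a < ρ / 2 := by
        by_contra! h4
        have h5 : 2 / ρ < ‖a‖ := by
          by_contra! h6
          exact absurd (ha.2 h6) (not_lt.mpr h4)
        rw [div_lt_iff₀ hρ] at h5
        nlinarith
      have h6 : ‖a - b a‖ = δ a := by rw [← dist_eq_norm, ← hbd a]
      have h7 : ρ ≤ ‖z - b a‖ := by
        rw [← dist_eq_norm]
        exact (hKρ z hz).trans (Metric.infDist_le_dist_of_mem (hb a))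
      rw [div_le_iff₀ (by linarith), h6]
      linarith

/-- The parameters of `IsOpen.exists_holomorphic_parameter` at the points of a locally finite
subset. -/
theorem IsOpen.exists_locallyFinite_parameter {D Z : Set ℂ} (hD : IsOpen D) (hZD : Z ⊆ D)
    (hZ : ∀ K ⊆ D, IsCompact K → (Z ∩ K).Finite) :
    Countable Z ∧ ∃ w : Z → ℂ → ℂ, (∀ a : Z, DifferentiableOn ℂ (w a) D ∧
      (∀ z ∈ D, w a z = 1 ↔ z = a) ∧ deriv (w a) a ≠ 0) ∧
      ∀ z₀ ∈ D, ∃ U ⊆ D, IsOpen U ∧ z₀ ∈ U ∧ ∃ S : Finset Z, ∀ a ∉ S, ∀ z ∈ U, ‖w a z‖ ≤ 1 / 2 := by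
  obtain ⟨w, hw, hK⟩ := hD.exists_holomorphic_parameter
  have key : ∀ z₀ ∈ D, ∃ U ⊆ D, IsOpen U ∧ z₀ ∈ U ∧
      ∃ S : Finset Z, ∀ a ∉ S, ∀ z ∈ U, ‖w a z‖ ≤ 1 / 2 := by
    intro z₀ hz₀
    obtain ⟨r, hr, hrD⟩ := Metric.nhds_basis_closedBall.mem_iff.mp (hD.mem_nhds hz₀)
    obtain ⟨K', hK'D, hK', hsmall⟩ := hK _ hrD (isCompact_closedBall _ _)
    refine ⟨Metric.ball z₀ r, Metric.ball_subset_closedBall.trans hrD, Metric.isOpen_ball,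
      Metric.mem_ball_self hr, ?_⟩
    have hfin : {a : Z | (a : ℂ) ∈ K'}.Finite := by
      refine Set.Finite.of_finite_image ((hZ K' hK'D hK').subset ?_) Subtype.val_injective.injOn
      rintro _ ⟨a, ha, rfl⟩
      exact ⟨a.2, ha⟩
    refine ⟨hfin.toFinset, fun a ha z hz => hsmall a (hZD a.2) ?_ z (Metric.ball_subset_closedBall hz)⟩
    simpa using ha
  refine ⟨?_, fun a => w a, fun a => hw a (hZD a.2), key⟩
  choose! U hUD hUo hmem S hS using key
  obtain ⟨t, htD, htc, ht⟩ := TopologicalSpace.countable_cover_nhdsWithin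
    (f := U) (s := D) fun x hx => mem_nhdsWithin_of_mem_nhds ((hUo x hx).mem_nhds (hmem x hx))
  have : Z ⊆ ⋃ x ∈ t, Subtype.val '' (S x : Set Z) := by
    intro a ha
    obtain ⟨x, hx, hax⟩ := Set.mem_iUnion₂.mp (ht (hZD ha))
    refine Set.mem_iUnion₂.mpr ⟨x, hx, ⟨a, ha⟩, ?_, rfl⟩
    by_contra h
    have h1 := hS x (htD hx) ⟨a, ha⟩ h a hax
    rw [((hw a (hZD ha)).2.1 a (hZD ha)).mpr rfl] at h1
    norm_num at h1
  exact ((htc.biUnion fun x _ => ((S x).countable_toSet.image _)).mono this).to_subtype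

section

open Filter Topology

theorem meromorphicOrderAt_add_nonneg {f g : ℂ → ℂ} {x : ℂ} (hf : MeromorphicAt f x)
    (hg : MeromorphicAt g x) (hf0 : 0 ≤ meromorphicOrderAt f x)
    (hg0 : 0 ≤ meromorphicOrderAt g x) : 0 ≤ meromorphicOrderAt (f + g) x :=
  (le_min hf0 hg0).trans (meromorphicOrderAt_add hf hg)

/-- The principal part of a meromorphic function, as a polynomial in the inverse of a local
parameter `s`. -/
theorem MeromorphicAt.exists_principalPart {φ s : ℂ → ℂ} {a : ℂ} (hφ : MeromorphicAt φ a)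
    (hs : AnalyticAt ℂ s a) (hs1 : meromorphicOrderAt s a = 1) :
    ∃ P : Polynomial ℂ, 0 ≤ meromorphicOrderAt (fun z => φ z - P.eval (s z)⁻¹) a := by
  have main : ∀ k : ℕ, ∀ φ : ℂ → ℂ, MeromorphicAt φ a →
      ((-k : ℤ) : WithTop ℤ) ≤ meromorphicOrderAt φ a →
      ∃ P : Polynomial ℂ, 0 ≤ meromorphicOrderAt (fun z => φ z - P.eval (s z)⁻¹) a := by
    intro k
    induction k with
    | zero => exact fun φ _ h => ⟨0, by simpa using h⟩
    | succ k ih =>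
      intro φ hφ h
      have hsm := hs.meromorphicAt
      have hχ : MeromorphicAt (s ^ (k + 1) * φ) a := (hsm.pow _).mul hφ
      have hχ0 : 0 ≤ meromorphicOrderAt (s ^ (k + 1) * φ) a := by
        rw [meromorphicOrderAt_mul (hsm.pow _) hφ, meromorphicOrderAt_pow hsm, hs1]
        cases h' : meromorphicOrderAt φ a with
        | top => simp
        | coe n =>
          rw [h', WithTop.coe_le_coe] at h
          rw [mul_one]
          change ((0 : ℤ) : WithTop ℤ) ≤ (((k + 1 : ℕ) : ℤ) : WithTop ℤ) + n
          rw [← WithTop.coe_add, WithTop.coe_le_coe]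
          omega
      obtain ⟨c, hc⟩ := tendsto_nhds_of_meromorphicOrderAt_nonneg hχ hχ0
      have hψ : MeromorphicAt (s ^ (k + 1) * φ - fun _ => c) a := hχ.sub (MeromorphicAt.const c a)
      have hψ0 : 0 < meromorphicOrderAt (s ^ (k + 1) * φ - fun _ => c) a := by
        rw [← tendsto_zero_iff_meromorphicOrderAt_pos hψ]
        have := hc.sub (tendsto_const_nhds (x := c))
        rwa [sub_self] at this
      have hsne : ∀ᶠ z in 𝓝[≠] a, s z ≠ 0 := by
        rw [← meromorphicOrderAt_ne_top_iff_eventually_ne_zero hsm, hs1]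
        simp
      have hinv : MeromorphicAt (s ^ (k + 1))⁻¹ a := (hsm.pow _).inv
      obtain ⟨P, hP⟩ := ih ((s ^ (k + 1) * φ - fun _ => c) * (s ^ (k + 1))⁻¹) (hψ.mul hinv) (by
        rw [meromorphicOrderAt_mul hψ hinv, meromorphicOrderAt_inv, meromorphicOrderAt_pow hsm, hs1]
        cases h' : meromorphicOrderAt (s ^ (k + 1) * φ - fun _ => c) a with
        | top => simp
        | coe n =>
          rw [h'] at hψ0
          have hn : 0 < n := by exact_mod_cast hψ0
          rw [mul_one]
          change ((-k : ℤ) : WithTop ℤ) ≤ (n : WithTop ℤ) + -(((k + 1 : ℕ) : ℤ) : WithTop ℤ)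
          rw [← WithTop.LinearOrderedAddCommGroup.coe_neg, ← WithTop.coe_add, WithTop.coe_le_coe]
          omega)
      refine ⟨P + Polynomial.C c * Polynomial.X ^ (k + 1), hP.trans_eq (meromorphicOrderAt_congr ?_)⟩
      filter_upwards [hsne] with z hz
      simp only [Pi.mul_apply, Pi.sub_apply, Pi.pow_apply, Pi.inv_apply, Polynomial.eval_add,
        Polynomial.eval_mul, Polynomial.eval_C, Polynomial.eval_pow, Polynomial.eval_X]
      generalize P.eval (s z)⁻¹ = e
      have h1 : s z * (s z)⁻¹ = 1 := mul_inv_cancel₀ hz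
      have h2 : s z ^ (k + 1) * (s z)⁻¹ ^ (k + 1) = 1 := by rw [← mul_pow, h1, one_pow]
      rw [← inv_pow]
      linear_combination φ z * h2
  cases h : meromorphicOrderAt φ a with
  | top => exact main 0 φ hφ (by simp [h])
  | coe n =>
    refine main n.natAbs φ hφ ?_
    rw [h, WithTop.coe_le_coe]
    omega

/-- A series of functions that is normally convergent on `U` up to finitely many terms. -/
theorem exists_differentiableOn_hasSum_compl {ι : Type*} {R : ι → ℂ → ℂ} {ε : ι → ℝ}
    (hε : Summable ε) {U : Set ℂ} (hU : IsOpen U) {S : Finset ι}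
    (hR : ∀ a ∉ S, DifferentiableOn ℂ (R a) U) (hb : ∀ a ∉ S, ∀ z ∈ U, ‖R a z‖ ≤ ε a) :
    ∃ T : ℂ → ℂ, DifferentiableOn ℂ T U ∧
      ∀ z ∈ U, HasSum (fun a : ((S : Set ι)ᶜ : Set ι) => R a z) (T z) := by
  have hε' : Summable fun a : ((S : Set ι)ᶜ : Set ι) => ε a := hε.subtype _
  refine ⟨fun z => ∑' a : ((S : Set ι)ᶜ : Set ι), R a z,
    Complex.differentiableOn_tsum_of_summable_norm hε' (fun a => hR a a.2) hU fun a => hb a a.2, ?_⟩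
  exact fun z hz => (Summable.of_norm_bounded hε' fun a => hb a a.2 z hz).hasSum

theorem exists_pos_summable (ι : Type*) [Countable ι] : ∃ ε : ι → ℝ, (∀ i, 0 < ε i) ∧ Summable ε := by
  have := Encodable.ofCountable ι
  obtain ⟨ε, h, c, hc, -⟩ := posSumOfEncodable one_pos ι
  exact ⟨ε, h, hc.summable⟩

theorem analyticOrderAt_one_sub_parameter {w : ℂ → ℂ} {a : ℂ} (hw : AnalyticAt ℂ w a)
    (h1 : w a = 1) (hd : deriv w a ≠ 0) : analyticOrderAt (fun z => 1 - w z) a = 1 := by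
  refine AnalyticAt.analyticOrderAt_eq_one_of_zero_deriv_ne_zero (by fun_prop) (by simp [h1]) ?_
  simpa [deriv_const_sub] using hd

/-- **Mittag-Leffler theorem** on an open subset of the plane. -/
theorem exists_meromorphicOn_sub_order_nonneg {D Z : Set ℂ} (hD : IsOpen D) (hZD : Z ⊆ D)
    (hZ : ∀ K ⊆ D, IsCompact K → (Z ∩ K).Finite) {φ : ℂ → ℂ} (hφ : MeromorphicOn φ D) :
    ∃ h : ℂ → ℂ, MeromorphicOn h D ∧ (∀ z ∈ D, z ∉ Z → 0 ≤ meromorphicOrderAt h z) ∧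
      ∀ a ∈ Z, 0 ≤ meromorphicOrderAt (h - φ) a := by
  classical
  obtain ⟨hcount, w, hw, hloc⟩ := hD.exists_locallyFinite_parameter hZD hZ
  obtain ⟨ε, hε0, hε⟩ := exists_pos_summable Z
  have hwan : ∀ a : Z, ∀ z ∈ D, AnalyticAt ℂ (w a) z := fun a z hz =>
    (hw a).1.analyticAt (hD.mem_nhds hz)
  have h1 : ∀ a : Z, ∃ P : Polynomial ℂ,
      0 ≤ meromorphicOrderAt (fun z => φ z - P.eval (1 - w a z)⁻¹) a := by
    intro a
    have hwa := hwan a a (hZD a.2)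
    have hs : AnalyticAt ℂ (fun z => 1 - w a z) a := by fun_prop
    refine (hφ a (hZD a.2)).exists_principalPart hs ?_
    rw [hs.meromorphicOrderAt_eq, analyticOrderAt_one_sub_parameter hwa
      (((hw a).2.1 a (hZD a.2)).mpr rfl) (hw a).2.2]
    rfl
  choose P hP using h1
  have h2 : ∀ a : Z, ∃ Q : ℂ → ℂ, Differentiable ℂ Q ∧ ∀ x, ‖x‖ ≤ 1 / 2 →
      ‖(P a).eval (1 - x)⁻¹ - Q x‖ ≤ ε a := by
    intro a
    refine exists_entire_norm_sub_le_of_differentiableOn_ball (fun x hx => ?_) (hε0 a)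
    have : 1 - x ≠ 0 := by
      intro h
      rw [← sub_eq_zero.mp h] at hx
      simp at hx
    refine DifferentiableAt.differentiableWithinAt ?_
    exact (P a).differentiable.differentiableAt.comp x (DifferentiableAt.inv (by fun_prop) this)
  choose Q hQ hPQ using h2
  set R : Z → ℂ → ℂ := fun a z => (P a).eval (1 - w a z)⁻¹ - Q a (w a z) with hR
  have hQan : ∀ a : Z, ∀ z ∈ D, AnalyticAt ℂ (fun z => Q a (w a z)) z := fun a z hz =>
    ((hQ a).analyticAt _).comp (hwan a z hz)
  have hRan : ∀ a : Z, ∀ z ∈ D, z ≠ a → AnalyticAt ℂ (R a) z := by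
    intro a z hz hza
    refine AnalyticAt.sub ?_ (hQan a z hz)
    have h3 : 1 - w a z ≠ 0 := fun h => hza (((hw a).2.1 z hz).mp (sub_eq_zero.mp h).symm)
    exact AnalyticAt.comp (g := fun x => (P a).eval x) ((P a).differentiable.analyticAt _)
      ((analyticAt_const.sub (hwan a z hz)).inv h3)
  have hRmer : ∀ a : Z, ∀ z ∈ D, MeromorphicAt (R a) z := by
    intro a z hz
    refine MeromorphicAt.sub ?_ (hQan a z hz).meromorphicAt
    have := (hwan a z hz).meromorphicAt
    simp only [Polynomial.eval_eq_sum_range]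
    fun_prop
  have hRord : ∀ a : Z, 0 ≤ meromorphicOrderAt (R a - φ) a := by
    intro a
    have h3 : R a - φ = -((fun z => φ z - (P a).eval (1 - w a z)⁻¹) + fun z => Q a (w a z)) := by
      ext z
      simp [hR]
      ring
    have hwa := (hwan a a (hZD a.2)).meromorphicAt
    have hφa := hφ a (hZD a.2)
    rw [h3, ← meromorphicOrderAt_neg]
    refine meromorphicOrderAt_add_nonneg ?_ (hQan a a (hZD a.2)).meromorphicAt (hP a)
      (hQan a a (hZD a.2)).meromorphicOrderAt_nonneg
    simp only [Polynomial.eval_eq_sum_range]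
    fun_prop
  have hlocal : ∀ z₀ ∈ D, ∃ S : Finset Z, (∀ a : Z, (a : ℂ) = z₀ → a ∈ S) ∧ ∃ T : ℂ → ℂ,
      AnalyticAt ℂ T z₀ ∧ (fun z => ∑' a, R a z) =ᶠ[𝓝 z₀] (∑ a ∈ S, R a) + T := by
    intro z₀ hz₀
    obtain ⟨U, hUD, hU, hz₀U, S, hS⟩ := hloc z₀ hz₀
    have hne : ∀ a : Z, a ∉ S → ∀ z ∈ U, z ≠ a := by
      rintro a ha z hz rfl
      have h3 := hS a ha a hz
      rw [((hw a).2.1 a (hUD hz)).mpr rfl] at h3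
      norm_num at h3
    obtain ⟨T, hT, hTsum⟩ := exists_differentiableOn_hasSum_compl (R := R) hε hU (S := S)
      (fun a ha z hz =>
        (hRan a z (hUD hz) (hne a ha z hz)).differentiableAt.differentiableWithinAt)
      (fun a ha z hz => hPQ a _ (hS a ha z hz))
    refine ⟨S, ?_, T, hT.analyticAt (hU.mem_nhds hz₀U), ?_⟩
    · rintro a rfl
      by_contra h
      exact hne a h a hz₀U rfl
    · filter_upwards [hU.mem_nhds hz₀U] with z hz
      have h3 := (S.hasSum fun a => R a z).add_compl (hTsum z hz)
      rw [h3.tsum_eq]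
      simp
  refine ⟨fun z => ∑' a, R a z, ?_, ?_, ?_⟩
  · intro z₀ hz₀
    obtain ⟨S, -, T, hT, hE⟩ := hlocal z₀ hz₀
    exact ((MeromorphicAt.sum fun a _ => hRmer a z₀ hz₀).add hT.meromorphicAt).congr
      (hE.symm.filter_mono nhdsWithin_le_nhds)
  · intro z₀ hz₀ hz₀Z
    obtain ⟨S, -, T, hT, hE⟩ := hlocal z₀ hz₀
    refine AnalyticAt.meromorphicOrderAt_nonneg (AnalyticAt.congr ?_ hE.symm)
    exact (Finset.analyticAt_sum _ fun a _ => hRan a z₀ hz₀ fun h => hz₀Z (h ▸ a.2)).add hT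
  · intro a ha
    have haD := hZD ha
    obtain ⟨S, hS, T, hT, hE⟩ := hlocal a haD
    have haS := hS ⟨a, ha⟩ rfl
    have hrest : AnalyticAt ℂ (∑ b ∈ S.erase ⟨a, ha⟩, R b + T) a := by
      refine (Finset.analyticAt_sum _ fun b hb => hRan b a haD fun h => ?_).add hT
      exact (Finset.mem_erase.mp hb).1 (Subtype.ext h.symm)
    have hE' : (fun z => ∑' a, R a z) - φ =ᶠ[𝓝 a]
        (R ⟨a, ha⟩ - φ) + (∑ b ∈ S.erase ⟨a, ha⟩, R b + T) := by
      filter_upwards [hE] with z hz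
      rw [Pi.sub_apply, hz, ← Finset.add_sum_erase _ _ haS]
      simp only [Pi.add_apply, Pi.sub_apply]
      ring
    rw [meromorphicOrderAt_congr (hE'.filter_mono nhdsWithin_le_nhds)]
    exact meromorphicOrderAt_add_nonneg ((hRmer _ a haD).sub (hφ a haD)) hrest.meromorphicAt
      (hRord ⟨a, ha⟩) hrest.meromorphicOrderAt_nonneg

/-- **Weierstrass theorem** on an open subset of the plane: there is a holomorphic function with
prescribed zeros. -/
theorem exists_analyticOnNhd_analyticOrderAt_eq {D Z : Set ℂ} (hD : IsOpen D) (hZD : Z ⊆ D)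
    (hZ : ∀ K ⊆ D, IsCompact K → (Z ∩ K).Finite) (m : ℂ → ℕ) :
    ∃ g : ℂ → ℂ, AnalyticOnNhd ℂ g D ∧ (∀ z ∈ D, z ∉ Z → analyticOrderAt g z = 0) ∧
      ∀ a ∈ Z, analyticOrderAt g a = m a := by
  classical
  obtain ⟨hcount, w, hw, hloc⟩ := hD.exists_locallyFinite_parameter hZD hZ
  obtain ⟨ε, hε0, hε⟩ := exists_pos_summable Z
  have hwan : ∀ a : Z, ∀ z ∈ D, AnalyticAt ℂ (w a) z := fun a z hz =>
    (hw a).1.analyticAt (hD.mem_nhds hz)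
  have hslit : ∀ x : ℂ, ‖x‖ < 1 → 1 - x ∈ Complex.slitPlane := fun x hx => by
    rw [sub_eq_add_neg]
    exact Complex.mem_slitPlane_of_norm_lt_one (by simpa using hx)
  have h2 : ∀ a : Z, ∃ Q : ℂ → ℂ, Differentiable ℂ Q ∧ ∀ x, ‖x‖ ≤ 1 / 2 →
      ‖m a * Complex.log (1 - x) - Q x‖ ≤ ε a := by
    intro a
    refine exists_entire_norm_sub_le_of_differentiableOn_ball (fun x hx => ?_) (hε0 a)
    refine DifferentiableAt.differentiableWithinAt (DifferentiableAt.const_mul ?_ _)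
    exact DifferentiableAt.clog (by fun_prop) (hslit x (by simpa using hx))
  choose Q hQ hPQ using h2
  set E : Z → ℂ → ℂ := fun a z => (1 - w a z) ^ m a * Complex.exp (-Q a (w a z)) with hEdef
  have hQan : ∀ a : Z, ∀ z ∈ D, AnalyticAt ℂ (fun z => Q a (w a z)) z := fun a z hz =>
    ((hQ a).analyticAt _).comp (hwan a z hz)
  have hEan : ∀ a : Z, ∀ z ∈ D, AnalyticAt ℂ (E a) z := by
    intro a z hz
    have h3 := hwan a z hz
    have h4 := hQan a z hz
    exact ((analyticAt_const.sub h3).pow _).mul h4.neg.cexp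
  have hEne : ∀ a : Z, ∀ z ∈ D, z ≠ a → E a z ≠ 0 := by
    intro a z hz hza
    have h3 : 1 - w a z ≠ 0 := fun h => hza (((hw a).2.1 z hz).mp (sub_eq_zero.mp h).symm)
    exact mul_ne_zero (pow_ne_zero _ h3) (Complex.exp_ne_zero _)
  have hlocal : ∀ z₀ ∈ D, ∃ S : Finset Z, (∀ a : Z, (a : ℂ) = z₀ → a ∈ S) ∧ ∃ T : ℂ → ℂ,
      AnalyticAt ℂ T z₀ ∧ T z₀ ≠ 0 ∧ (fun z => ∏' a, E a z) =ᶠ[𝓝 z₀] (∏ a ∈ S, E a) * T := by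
    intro z₀ hz₀
    obtain ⟨U, hUD, hU, hz₀U, S, hS⟩ := hloc z₀ hz₀
    have hlt : ∀ a : Z, a ∉ S → ∀ z ∈ U, ‖w a z‖ < 1 := fun a ha z hz =>
      (hS a ha z hz).trans_lt (by norm_num)
    obtain ⟨T, hT, hTsum⟩ := exists_differentiableOn_hasSum_compl
      (R := fun (a : Z) z => m a * Complex.log (1 - w a z) - Q a (w a z)) hε hU (S := S)
      (fun a ha z hz => by
        have h3 := (hwan a z (hUD hz)).differentiableAt
        have h4 := (hQan a z (hUD hz)).differentiableAt
        refine DifferentiableAt.differentiableWithinAt (DifferentiableAt.sub ?_ h4)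
        refine DifferentiableAt.const_mul (DifferentiableAt.clog (by fun_prop) ?_) _
        exact hslit _ (hlt a ha z hz))
      (fun a ha z hz => hPQ a _ (hS a ha z hz))
    refine ⟨S, ?_, fun z => Complex.exp (T z), (hT.analyticAt (hU.mem_nhds hz₀U)).cexp,
      Complex.exp_ne_zero _, ?_⟩
    · rintro a rfl
      by_contra h
      have h3 := hlt a h a hz₀U
      rw [((hw a).2.1 a hz₀).mpr rfl] at h3
      norm_num at h3
    · filter_upwards [hU.mem_nhds hz₀U] with z hz
      have h3 : HasProd (fun a : ((S : Set Z)ᶜ : Set Z) => E a z) (Complex.exp (T z)) := by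
        refine (hTsum z hz).cexp.congr fun s => ?_
        refine Finset.prod_congr rfl fun a _ => ?_
        have h4 := Complex.slitPlane_ne_zero (hslit _ (hlt a a.2 z hz))
        simp only [Function.comp_apply, hEdef, sub_eq_add_neg _ (Q _ _), Complex.exp_add,
          Complex.exp_nat_mul, Complex.exp_log h4]
      have h5 := (S.hasProd fun a => E a z).mul_compl h3
      rw [h5.tprod_eq]
      simp
  refine ⟨fun z => ∏' a, E a z, ?_, ?_, ?_⟩
  · intro z₀ hz₀
    obtain ⟨S, -, T, hT, -, hE⟩ := hlocal z₀ hz₀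
    exact ((Finset.analyticAt_prod _ fun a _ => hEan a z₀ hz₀).mul hT).congr hE.symm
  · intro z₀ hz₀ hz₀Z
    obtain ⟨S, -, T, hT, hT0, hE⟩ := hlocal z₀ hz₀
    rw [analyticOrderAt_congr hE]
    refine analyticOrderAt_eq_zero.mpr (Or.inr (mul_ne_zero ?_ hT0))
    rw [Finset.prod_apply]
    exact Finset.prod_ne_zero_iff.mpr fun a _ => hEne a z₀ hz₀ fun h => hz₀Z (h ▸ a.2)
  · intro a ha
    have haD := hZD ha
    obtain ⟨S, hS, T, hT, hT0, hE⟩ := hlocal a haD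
    have haS := hS ⟨a, ha⟩ rfl
    have hwa := hwan ⟨a, ha⟩ a haD
    have hs : AnalyticAt ℂ (fun z => 1 - w ⟨a, ha⟩ z) a := by fun_prop
    have hrest : AnalyticAt ℂ ((fun z => Complex.exp (-Q ⟨a, ha⟩ (w ⟨a, ha⟩ z))) *
        ((∏ b ∈ S.erase ⟨a, ha⟩, E b) * T)) a :=
      (hQan ⟨a, ha⟩ a haD).neg.cexp.mul
        ((Finset.analyticAt_prod _ fun b _ => hEan b a haD).mul hT)
    have hE' : (fun z => ∏' a, E a z) =ᶠ[𝓝 a] ((fun z => 1 - w ⟨a, ha⟩ z) ^ m a) *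
        ((fun z => Complex.exp (-Q ⟨a, ha⟩ (w ⟨a, ha⟩ z))) * ((∏ b ∈ S.erase ⟨a, ha⟩, E b) * T)) := by
      filter_upwards [hE] with z hz
      rw [hz, ← Finset.mul_prod_erase _ _ haS]
      simp only [Pi.mul_apply, Pi.pow_apply]
      rw [show E ⟨a, ha⟩ z = (1 - w ⟨a, ha⟩ z) ^ m a *
        Complex.exp (-Q ⟨a, ha⟩ (w ⟨a, ha⟩ z)) from rfl]
      ring
    rw [analyticOrderAt_congr hE', analyticOrderAt_mul (hs.pow _) hrest, analyticOrderAt_pow hs,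
      analyticOrderAt_one_sub_parameter hwa (((hw ⟨a, ha⟩).2.1 a haD).mpr rfl) (hw _).2.2]
    have : analyticOrderAt ((fun z => Complex.exp (-Q ⟨a, ha⟩ (w ⟨a, ha⟩ z))) *
        ((∏ b ∈ S.erase ⟨a, ha⟩, E b) * T)) a = 0 := by
      refine analyticOrderAt_eq_zero.mpr (Or.inr (mul_ne_zero (Complex.exp_ne_zero _)
        (mul_ne_zero ?_ hT0)))
      rw [Finset.prod_apply]
      refine Finset.prod_ne_zero_iff.mpr fun b hb => hEne b a haD fun h => ?_
      exact (Finset.mem_erase.mp hb).1 (Subtype.ext h.symm)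
    rw [this]
    simp

/-- Removable singularities: a meromorphic function without poles agrees with an analytic one. -/
theorem MeromorphicOn.exists_analyticOnNhd {D : Set ℂ} {k : ℂ → ℂ} (hk : MeromorphicOn k D)
    (h0 : ∀ z ∈ D, 0 ≤ meromorphicOrderAt k z) :
    ∃ k' : ℂ → ℂ, AnalyticOnNhd ℂ k' D ∧ ∀ z ∈ D, k' =ᶠ[𝓝[≠] z] k := by
  refine ⟨toMeromorphicNFOn k D, fun z hz => ?_, fun z hz =>
    hk.toMeromorphicNFOn_eq_self_on_nhdsNE hz⟩
  refine ((meromorphicNFOn_toMeromorphicNFOn k D) hz).meromorphicOrderAt_nonneg_iff_analyticAt.mp ?_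
  rw [meromorphicOrderAt_toMeromorphicNFOn hk hz]
  exact h0 z hz

theorem AnalyticAt.eq_of_eventuallyEq_nhdsNE {f g : ℂ → ℂ} {z : ℂ} (hf : AnalyticAt ℂ f z)
    (hg : AnalyticAt ℂ g z) (h : f =ᶠ[𝓝[≠] z] g) : f z = g z :=
  ((hf.frequently_eq_iff_eventually_eq hg).mp h.frequently).self_of_nhds

/-- Division of holomorphic functions. -/
theorem AnalyticOnNhd.exists_eq_mul_of_analyticOrderAt_le {D : Set ℂ} {f g : ℂ → ℂ}
    (hf : AnalyticOnNhd ℂ f D) (hg : AnalyticOnNhd ℂ g D)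
    (hgt : ∀ z ∈ D, analyticOrderAt g z ≠ ⊤)
    (hle : ∀ z ∈ D, analyticOrderAt g z ≤ analyticOrderAt f z) :
    ∃ k : ℂ → ℂ, AnalyticOnNhd ℂ k D ∧ ∀ z ∈ D, f z = g z * k z := by
  have hmer : MeromorphicOn (f * g⁻¹) D := fun z hz =>
    (hf z hz).meromorphicAt.mul (hg z hz).meromorphicAt.inv
  obtain ⟨k, hk, hkE⟩ := hmer.exists_analyticOnNhd fun z hz => by
    rw [meromorphicOrderAt_mul (hf z hz).meromorphicAt (hg z hz).meromorphicAt.inv,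
      meromorphicOrderAt_inv, (hf z hz).meromorphicOrderAt_eq, (hg z hz).meromorphicOrderAt_eq]
    have h1 := hle z hz
    have h2 := hgt z hz
    cases hg' : analyticOrderAt g z with
    | top => exact absurd hg' h2
    | coe n =>
      cases hf' : analyticOrderAt f z with
      | top => simp
      | coe l =>
        rw [hg', hf'] at h1
        have h3 : n ≤ l := by exact_mod_cast h1
        simp only [ENat.map_natCast]
        norm_cast
        omega
  refine ⟨k, hk, fun z hz => ?_⟩
  refine (hf z hz).eq_of_eventuallyEq_nhdsNE (g := g * k) ((hg z hz).mul (hk z hz)) ?_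
  have h3 := ((hg z hz).eventually_eq_zero_or_eventually_ne_zero).resolve_left
    (fun h => hgt z hz (analyticOrderAt_eq_top.mpr h))
  filter_upwards [h3, hkE z hz] with x hx hkx
  rw [Pi.mul_apply, hkx, Pi.mul_apply, Pi.inv_apply]
  field_simp

/-- Holomorphic functions without common zeros are coprime. -/
theorem AnalyticOnNhd.exists_mul_add_mul_eq_one {D : Set ℂ} (hD : IsOpen D) {f g : ℂ → ℂ}
    (hf : AnalyticOnNhd ℂ f D) (hg : AnalyticOnNhd ℂ g D)
    (hZ : ∀ K ⊆ D, IsCompact K → ({z ∈ D | g z = 0} ∩ K).Finite)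
    (hgt : ∀ z ∈ D, analyticOrderAt g z ≠ ⊤) (hfg : ∀ z ∈ D, f z = 0 → g z ≠ 0) :
    ∃ u v : ℂ → ℂ, AnalyticOnNhd ℂ u D ∧ AnalyticOnNhd ℂ v D ∧
      ∀ z ∈ D, u z * f z + v z * g z = 1 := by
  have hfm : ∀ z ∈ D, MeromorphicAt f z := fun z hz => (hf z hz).meromorphicAt
  have hgm : ∀ z ∈ D, MeromorphicAt g z := fun z hz => (hg z hz).meromorphicAt
  have hgne : ∀ z ∈ D, ∀ᶠ x in 𝓝[≠] z, g x ≠ 0 := fun z hz =>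
    ((hg z hz).eventually_eq_zero_or_eventually_ne_zero).resolve_left
      (fun h => hgt z hz (analyticOrderAt_eq_top.mpr h))
  obtain ⟨h, hh, hh0, hhφ⟩ := exists_meromorphicOn_sub_order_nonneg hD (fun z hz => hz.1) hZ
    (φ := f⁻¹ * g⁻¹) fun z hz => (hfm z hz).inv.mul (hgm z hz).inv
  have hf0 : ∀ z ∈ D, 0 ≤ meromorphicOrderAt f z := fun z hz => (hf z hz).meromorphicOrderAt_nonneg
  have hg0 : ∀ z ∈ D, 0 ≤ meromorphicOrderAt g z := fun z hz => (hg z hz).meromorphicOrderAt_nonneg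
  have hfinv : ∀ z ∈ D, g z = 0 → AnalyticAt ℂ f⁻¹ z := fun z hz hgz =>
    (hf z hz).inv fun h => hfg z hz h hgz
  have hu : MeromorphicOn (g * h) D := fun z hz => (hgm z hz).mul (hh z hz)
  have hv : MeromorphicOn (g⁻¹ - f * h) D := fun z hz =>
    (hgm z hz).inv.sub ((hfm z hz).mul (hh z hz))
  have hd : ∀ z ∈ D, MeromorphicAt (h - f⁻¹ * g⁻¹) z := fun z hz =>
    (hh z hz).sub ((hfm z hz).inv.mul (hgm z hz).inv)
  obtain ⟨u, hua, huE⟩ := hu.exists_analyticOnNhd fun z hz => by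
    by_cases hgz : g z = 0
    · have h1 : g * h =ᶠ[𝓝[≠] z] g * (h - f⁻¹ * g⁻¹) + f⁻¹ := by
        filter_upwards [hgne z hz] with x hx
        simp only [Pi.mul_apply, Pi.add_apply, Pi.sub_apply, Pi.inv_apply]
        linear_combination (f x)⁻¹ * mul_inv_cancel₀ hx
      rw [meromorphicOrderAt_congr h1]
      refine meromorphicOrderAt_add_nonneg ((hgm z hz).mul (hd z hz)) (hfm z hz).inv ?_
        (hfinv z hz hgz).meromorphicOrderAt_nonneg
      rw [meromorphicOrderAt_mul (hgm z hz) (hd z hz)]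
      exact add_nonneg (hg0 z hz) (hhφ z ⟨hz, hgz⟩)
    · rw [meromorphicOrderAt_mul (hgm z hz) (hh z hz)]
      exact add_nonneg (hg0 z hz) (hh0 z hz fun h => hgz h.2)
  obtain ⟨v, hva, hvE⟩ := hv.exists_analyticOnNhd fun z hz => by
    by_cases hgz : g z = 0
    · have h1 : g⁻¹ - f * h =ᶠ[𝓝[≠] z] -(f * (h - f⁻¹ * g⁻¹)) := by
        have h2 : ∀ᶠ x in 𝓝 z, f x ≠ 0 :=
          (hf z hz).continuousAt.eventually_ne fun h => hfg z hz h hgz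
        filter_upwards [h2.filter_mono nhdsWithin_le_nhds] with x hx
        simp only [Pi.mul_apply, Pi.neg_apply, Pi.sub_apply, Pi.inv_apply]
        linear_combination -(g x)⁻¹ * mul_inv_cancel₀ hx
      rw [meromorphicOrderAt_congr h1, ← meromorphicOrderAt_neg,
        meromorphicOrderAt_mul (hfm z hz) (hd z hz)]
      exact add_nonneg (hf0 z hz) (hhφ z ⟨hz, hgz⟩)
    · rw [sub_eq_add_neg]
      refine meromorphicOrderAt_add_nonneg (hgm z hz).inv ((hfm z hz).mul (hh z hz)).neg
        ((hg z hz).inv hgz).meromorphicOrderAt_nonneg ?_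
      rw [← meromorphicOrderAt_neg, meromorphicOrderAt_mul (hfm z hz) (hh z hz)]
      exact add_nonneg (hf0 z hz) (hh0 z hz fun h => hgz h.2)
  refine ⟨u, v, hua, hva, fun z hz => ?_⟩
  refine AnalyticAt.eq_of_eventuallyEq_nhdsNE (f := u * f + v * g) (g := fun _ => 1)
    (((hua z hz).mul (hf z hz)).add ((hva z hz).mul (hg z hz))) analyticAt_const ?_
  filter_upwards [huE z hz, hvE z hz, hgne z hz] with x h1 h2 h3
  simp only [Pi.mul_apply, Pi.add_apply, h1, h2, Pi.sub_apply, Pi.inv_apply]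
  linear_combination mul_inv_cancel₀ h3

/-- The zeros of a holomorphic function on a preconnected set are locally finite. -/
theorem AnalyticOnNhd.finite_zeros_inter {D K : Set ℂ} {f : ℂ → ℂ} (hf : AnalyticOnNhd ℂ f D)
    (hft : ∀ z ∈ D, analyticOrderAt f z ≠ ⊤) (hKD : K ⊆ D) (hK : IsCompact K) :
    ({z ∈ D | f z = 0} ∩ K).Finite := by
  by_contra hinf
  obtain ⟨x, hxK, hx⟩ := Set.Infinite.exists_accPt_of_subset_isCompact hinf hK Set.inter_subset_right
  refine hft x (hKD hxK) (analyticOrderAt_eq_top.mpr ?_)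
  refine (hf x (hKD hxK)).frequently_zero_iff_eventually_zero.mp ?_
  exact (accPt_iff_frequently_nhdsNE.mp hx).mono fun y hy => hy.1.2

end

/-- The extension by zero of a holomorphic function on `D`. -/
noncomputable def holomorphicExtend {D : Set ℂ} (f : holomorphicAlgebra D) : ℂ → ℂ :=
  Function.extend Subtype.val f.1 0

section HolomorphicAlgebra

variable {D : Set ℂ}

@[simp]
theorem holomorphicExtend_apply (f : holomorphicAlgebra D) (ζ : D) :
    holomorphicExtend f ζ = f.1 ζ :=
  Subtype.val_injective.extend_apply _ _ _

theorem zeroOrder_eq (f : holomorphicAlgebra D) (ζ : D) :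
    zeroOrder f ζ = analyticOrderAt (holomorphicExtend f) ζ := rfl

theorem analyticOnNhd_holomorphicExtend (hD : IsOpen D) (f : holomorphicAlgebra D) :
    AnalyticOnNhd ℂ (holomorphicExtend f) D := by
  obtain ⟨F, hF, hFf⟩ := f.2
  refine DifferentiableOn.analyticOnNhd (hF.congr fun z hz => ?_) hD
  rw [hFf ⟨z, hz⟩, ← holomorphicExtend_apply f ⟨z, hz⟩]

theorem AnalyticOnNhd.exists_holomorphicExtend_eqOn {F : ℂ → ℂ} (hF : AnalyticOnNhd ℂ F D) :
    ∃ f : holomorphicAlgebra D, Set.EqOn (holomorphicExtend f) F D :=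
  ⟨⟨fun z => F z, F, hF.differentiableOn, fun _ => rfl⟩,
    fun z hz => holomorphicExtend_apply _ ⟨z, hz⟩⟩

theorem zeroOrder_congr (hD : IsOpen D) {f : holomorphicAlgebra D} {F : ℂ → ℂ}
    (h : Set.EqOn (holomorphicExtend f) F D) (ζ : D) : zeroOrder f ζ = analyticOrderAt F ζ :=
  analyticOrderAt_congr (h.eventuallyEq_of_mem (hD.mem_nhds ζ.2))

theorem zeroOrder_mul (hD : IsOpen D) (f g : holomorphicAlgebra D) (ζ : D) :
    zeroOrder (f * g) ζ = zeroOrder f ζ + zeroOrder g ζ := by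
  rw [zeroOrder_congr hD (F := holomorphicExtend f * holomorphicExtend g) _ ζ,
    analyticOrderAt_mul (analyticOnNhd_holomorphicExtend hD f ζ ζ.2)
      (analyticOnNhd_holomorphicExtend hD g ζ ζ.2)]
  · rfl
  · intro z hz
    lift z to D using hz
    simp

theorem zeroOrder_ne_zero (hD : IsOpen D) {f : holomorphicAlgebra D} {ζ : D} :
    zeroOrder f ζ ≠ 0 ↔ f.1 ζ = 0 := by
  rw [zeroOrder_eq, (analyticOnNhd_holomorphicExtend hD f ζ ζ.2).analyticOrderAt_ne_zero,
    holomorphicExtend_apply]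

theorem zeroOrder_one (hD : IsOpen D) (ζ : D) : zeroOrder (1 : holomorphicAlgebra D) ζ = 0 := by
  by_contra h
  simpa using (zeroOrder_ne_zero hD).mp h

theorem zeroOrder_pow (hD : IsOpen D) (f : holomorphicAlgebra D) (n : ℕ) (ζ : D) :
    zeroOrder (f ^ n) ζ = n * zeroOrder f ζ := by
  induction n with
  | zero => simp [zeroOrder_one hD]
  | succ n ih => rw [pow_succ, zeroOrder_mul hD, ih, Nat.cast_succ, add_mul, one_mul]

theorem zeroOrder_zero (hD : IsOpen D) (ζ : D) : zeroOrder (0 : holomorphicAlgebra D) ζ = ⊤ := by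
  rw [zeroOrder_congr hD (F := 0) _ ζ]
  · exact analyticOrderAt_eq_top.mpr (by simp)
  · intro z hz
    lift z to D using hz
    simp

theorem zeroOrder_ne_top (hD : IsOpen D) (hDc : IsPreconnected D) {f : holomorphicAlgebra D}
    (hf : f ≠ 0) (ζ : D) : zeroOrder f ζ ≠ ⊤ := by
  intro h
  rw [zeroOrder_eq, analyticOrderAt_eq_top] at h
  refine hf (Subtype.ext (funext fun z => ?_))
  have h1 := (analyticOnNhd_holomorphicExtend hD f).eqOn_zero_of_preconnected_of_eventuallyEq_zero
    hDc ζ.2 h z.2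
  simpa using h1

theorem zeroOrder_le_supZeroOrder (hD : IsOpen D) (f : holomorphicAlgebra D) (ζ : D) :
    zeroOrder f ζ ≤ supZeroOrder f := by
  unfold supZeroOrder
  split_ifs with h
  · exact le_top
  · by_cases h0 : zeroOrder f ζ = 0
    · simp [h0]
    · exact le_iSup₂_of_le ζ ((zeroOrder_ne_zero hD).mp h0) le_rfl

theorem supZeroOrder_ne_top (hD : IsOpen D) (hDne : D.Nonempty) {f : holomorphicAlgebra D} {n : ℕ}
    (h : ∀ ζ, zeroOrder f ζ ≤ n) : supZeroOrder f ≠ ⊤ := by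
  have hf : f ≠ 0 := by
    rintro rfl
    have := h ⟨_, hDne.some_mem⟩
    rw [zeroOrder_zero hD] at this
    exact absurd this (by simp)
  rw [supZeroOrder, if_neg hf]
  exact ne_top_of_le_ne_top (ENat.natCast_ne_top n) (iSup₂_le fun ζ _ => h ζ)

/-- Prescribed zero orders on the zero set of a given nonzero holomorphic function. -/
theorem exists_zeroOrder_eq (hD : IsOpen D) (hDc : IsPreconnected D) {f : holomorphicAlgebra D}
    (hf : f ≠ 0) (m : D → ℕ) (hm : ∀ ζ, f.1 ζ ≠ 0 → m ζ = 0) :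
    ∃ g : holomorphicAlgebra D, ∀ ζ, zeroOrder g ζ = m ζ := by
  have hfa := analyticOnNhd_holomorphicExtend hD f
  obtain ⟨g, hg, hg0, hgm⟩ := exists_analyticOnNhd_analyticOrderAt_eq hD
    (Z := {z ∈ D | holomorphicExtend f z = 0}) (fun z hz => hz.1)
    (fun K hKD hK => hfa.finite_zeros_inter
      (fun z hz => zeroOrder_ne_top hD hDc hf ⟨z, hz⟩) hKD hK)
    (Function.extend Subtype.val m 0)
  obtain ⟨g', hg'⟩ := hg.exists_holomorphicExtend_eqOn
  refine ⟨g', fun ζ => ?_⟩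
  rw [zeroOrder_congr hD hg']
  by_cases h : f.1 ζ = 0
  · rw [hgm ζ ⟨ζ.2, by simpa using h⟩, Subtype.val_injective.extend_apply]
  · rw [hg0 ζ ζ.2 fun h' => h (by simpa using h'.2), hm ζ h, Nat.cast_zero]

theorem dvd_of_zeroOrder_le (hD : IsOpen D) (hDc : IsPreconnected D) {f g : holomorphicAlgebra D}
    (hg : g ≠ 0) (h : ∀ ζ, zeroOrder g ζ ≤ zeroOrder f ζ) : g ∣ f := by
  obtain ⟨k, hk, hkf⟩ := (analyticOnNhd_holomorphicExtend hD f).exists_eq_mul_of_analyticOrderAt_le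
    (analyticOnNhd_holomorphicExtend hD g) (fun z hz => zeroOrder_ne_top hD hDc hg ⟨z, hz⟩)
    (fun z hz => h ⟨z, hz⟩)
  obtain ⟨k', hk'⟩ := hk.exists_holomorphicExtend_eqOn
  refine ⟨k', Subtype.ext (funext fun z => ?_)⟩
  have h1 := hkf z z.2
  rw [← hk' z.2] at h1
  simpa using h1

theorem ne_zero_of_zeroOrder_ne_top (hD : IsOpen D) {f : holomorphicAlgebra D} {ζ : D}
    (h : zeroOrder f ζ ≠ ⊤) : f ≠ 0 := by
  rintro rfl
  exact h (zeroOrder_zero hD ζ)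

/-- Holomorphic functions on a domain without common zeros are coprime. -/
theorem isCoprime_of_no_common_zero (hD : IsOpen D) (hDc : IsConnected D)
    {f g : holomorphicAlgebra D} (h : ∀ ζ, f.1 ζ = 0 → g.1 ζ ≠ 0) : IsCoprime f g := by
  wlog hg : g ≠ 0 generalizing f g
  · rw [not_not] at hg
    subst hg
    refine (this (fun ζ _ h' => h ζ h' rfl) ?_).symm
    rintro rfl
    exact h ⟨_, hDc.nonempty.some_mem⟩ rfl rfl
  have hgt : ∀ z ∈ D, analyticOrderAt (holomorphicExtend g) z ≠ ⊤ := fun z hz =>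
    zeroOrder_ne_top hD hDc.isPreconnected hg ⟨z, hz⟩
  have hga := analyticOnNhd_holomorphicExtend hD g
  obtain ⟨u, v, hu, hv, huv⟩ := (analyticOnNhd_holomorphicExtend hD f).exists_mul_add_mul_eq_one hD
    hga (fun K hKD hK => hga.finite_zeros_inter hgt hKD hK) hgt
    (fun z hz => by
      lift z to D using hz
      simpa using h z)
  obtain ⟨u', hu'⟩ := hu.exists_holomorphicExtend_eqOn
  obtain ⟨v', hv'⟩ := hv.exists_holomorphicExtend_eqOn
  refine ⟨u', v', Subtype.ext (funext fun z => ?_)⟩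
  have h1 := huv z z.2
  rw [← hu' z.2, ← hv' z.2] at h1
  simpa using h1

theorem Ideal.exists_common_zero (hD : IsOpen D) (hDc : IsConnected D)
    {I : Ideal (holomorphicAlgebra D)} (hI : I ≠ ⊤) {f g : holomorphicAlgebra D} (hf : f ∈ I)
    (hg : g ∈ I) : ∃ ζ, f.1 ζ = 0 ∧ g.1 ζ = 0 := by
  by_contra! h
  obtain ⟨u, v, huv⟩ := isCoprime_of_no_common_zero hD hDc h
  exact hI ((Ideal.eq_top_iff_one I).mpr
    (huv ▸ I.add_mem (I.mul_mem_left u hf) (I.mul_mem_left v hg)))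

theorem Ideal.exists_mem_dvd_dvd (hD : IsOpen D) (hDc : IsConnected D)
    {I : Ideal (holomorphicAlgebra D)} {f g : holomorphicAlgebra D} (hf : f ∈ I)
    (hg : g ∈ I) : ∃ k ∈ I, k ∣ f ∧ k ∣ g := by
  rcases eq_or_ne f 0 with rfl | hf0
  · exact ⟨g, hg, dvd_zero _, dvd_rfl⟩
  rcases eq_or_ne g 0 with rfl | hg0
  · exact ⟨f, hf, dvd_rfl, dvd_zero _⟩
  have hft := zeroOrder_ne_top hD hDc.isPreconnected hf0
  have hgt := zeroOrder_ne_top hD hDc.isPreconnected hg0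
  have hmt : ∀ ζ, min (zeroOrder f ζ) (zeroOrder g ζ) ≠ ⊤ := fun ζ =>
    ne_top_of_le_ne_top (hft ζ) (min_le_left _ _)
  obtain ⟨k, hk⟩ := exists_zeroOrder_eq hD hDc.isPreconnected hf0
    (fun ζ => (min (zeroOrder f ζ) (zeroOrder g ζ)).toNat) (fun ζ hζ => by
      have : zeroOrder f ζ = 0 := by
        by_contra h
        exact hζ ((zeroOrder_ne_zero hD).mp h)
      simp [this])
  have hk' : ∀ ζ, zeroOrder k ζ = min (zeroOrder f ζ) (zeroOrder g ζ) := fun ζ => by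
    rw [hk, ENat.natCast_toNat (hmt ζ)]
  have hkt : ∀ ζ, zeroOrder k ζ ≠ ⊤ := fun ζ => by rw [hk']; exact hmt ζ
  have hk0 : k ≠ 0 := ne_zero_of_zeroOrder_ne_top hD (hkt ⟨_, hDc.nonempty.some_mem⟩)
  obtain ⟨a, rfl⟩ := dvd_of_zeroOrder_le hD hDc.isPreconnected hk0
    (f := f) fun ζ => (hk' ζ).trans_le (min_le_left _ _)
  obtain ⟨b, rfl⟩ := dvd_of_zeroOrder_le hD hDc.isPreconnected hk0
    (f := g) fun ζ => (hk' ζ).trans_le (min_le_right _ _)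
  refine ⟨k, ?_, dvd_mul_right _ _, dvd_mul_right _ _⟩
  obtain ⟨u, v, huv⟩ := isCoprime_of_no_common_zero hD hDc (f := a) (g := b) fun ζ ha hb => by
    have h1 := hk' ζ
    rw [zeroOrder_mul hD, zeroOrder_mul hD, min_add_add_left] at h1
    have h2 : min (zeroOrder a ζ) (zeroOrder b ζ) = 0 := by
      have h3 : zeroOrder k ζ + 0 = zeroOrder k ζ + min (zeroOrder a ζ) (zeroOrder b ζ) := by
        rw [add_zero]
        exact h1
      exact ((ENat.addLECancellable_of_ne_top (hkt ζ)).inj.mp h3).symm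
    rcases min_choice (zeroOrder a ζ) (zeroOrder b ζ) with h | h
    · exact (zeroOrder_ne_zero hD).mpr ha (h ▸ h2)
    · exact (zeroOrder_ne_zero hD).mpr hb (h ▸ h2)
  have : k = u * (k * a) + v * (k * b) := by linear_combination -k * huv
  rw [this]
  exact I.add_mem (I.mul_mem_left u hf) (I.mul_mem_left v hg)

theorem Ideal.exists_pow_dvd_of_mem_pow (hD : IsOpen D) (hDc : IsConnected D)
    {I : Ideal (holomorphicAlgebra D)} (n : ℕ) {q : holomorphicAlgebra D} (hq : q ∈ I ^ n) :
    ∃ a ∈ I, a ^ n ∣ q := by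
  induction n generalizing q with
  | zero => exact ⟨0, I.zero_mem, by simp⟩
  | succ n ih =>
    rw [pow_succ] at hq
    refine Submodule.mul_induction_on hq ?_ ?_
    · intro x hx y hy
      obtain ⟨a, ha, hax⟩ := ih hx
      obtain ⟨k, hk, hka, hky⟩ := Ideal.exists_mem_dvd_dvd hD hDc ha hy
      exact ⟨k, hk, pow_succ k n ▸ mul_dvd_mul ((pow_dvd_pow_of_dvd hka n).trans hax) hky⟩
    · rintro x y ⟨a, ha, hax⟩ ⟨b, hb, hby⟩
      obtain ⟨k, hk, hka, hkb⟩ := Ideal.exists_mem_dvd_dvd hD hDc ha hb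
      exact ⟨k, hk, dvd_add ((pow_dvd_pow_of_dvd hka _).trans hax)
        ((pow_dvd_pow_of_dvd hkb _).trans hby)⟩

theorem Ideal.IsMaximal.mem_of_zeros_subset (hD : IsOpen D) (hDc : IsConnected D)
    {M : Ideal (holomorphicAlgebra D)} (hM : M.IsMaximal) {f g : holomorphicAlgebra D} (hf : f ∈ M)
    (h : ∀ ζ, f.1 ζ = 0 → g.1 ζ = 0) : g ∈ M := by
  by_contra hg
  obtain ⟨y, i, hi, hyi⟩ := hM.exists_inv hg
  obtain ⟨ζ, h1, h2⟩ := Ideal.exists_common_zero hD hDc hM.ne_top hf hi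
  have h3 : y.1 ζ * g.1 ζ + i.1 ζ = 1 := congrFun (congrArg Subtype.val hyi) ζ
  simp [h ζ h1, h2] at h3

open Classical in
/-- A holomorphic function with simple zeros at the zeros of `f` that satisfy `p`. -/
theorem exists_simple_zeros (hD : IsOpen D) (hDc : IsPreconnected D) {f : holomorphicAlgebra D}
    (hf : f ≠ 0) (p : D → Prop) : ∃ g : holomorphicAlgebra D,
      ∀ ζ, zeroOrder g ζ = if f.1 ζ = 0 ∧ p ζ then 1 else 0 := by
  obtain ⟨g, hg⟩ := exists_zeroOrder_eq hD hDc hf (fun ζ => if f.1 ζ = 0 ∧ p ζ then 1 else 0)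
    (fun ζ hζ => by simp [hζ])
  exact ⟨g, fun ζ => by rw [hg]; split_ifs <;> simp⟩

theorem Ideal.IsMaximal.exists_factorization_of_notMem_pow (hD : IsOpen D) (hDc : IsConnected D)
    {M : Ideal (holomorphicAlgebra D)} (hM : M.IsMaximal) {f : holomorphicAlgebra D} {n : ℕ}
    (hf : f ∉ M ^ n) : ∃ q d, f = q * d ∧ d ∉ M ∧ ∀ ζ, zeroOrder q ζ ≤ n := by
  classical
  have hf0 : f ≠ 0 := fun h => hf (h ▸ (M ^ n).zero_mem)
  have hft := zeroOrder_ne_top hD hDc.isPreconnected hf0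
  obtain ⟨q, hq⟩ := exists_zeroOrder_eq hD hDc.isPreconnected hf0
    (fun ζ => if zeroOrder f ζ ≤ n then (zeroOrder f ζ).toNat else 0) (fun ζ hζ => by
      have : zeroOrder f ζ = 0 := by
        by_contra h
        exact hζ ((zeroOrder_ne_zero hD).mp h)
      simp [this])
  have hq1 : ∀ ζ, zeroOrder f ζ ≤ n → zeroOrder q ζ = zeroOrder f ζ := fun ζ h => by
    rw [hq, if_pos h, ENat.natCast_toNat (hft ζ)]
  have hq2 : ∀ ζ, ¬ zeroOrder f ζ ≤ n → zeroOrder q ζ = 0 := fun ζ h => by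
    rw [hq, if_neg h, Nat.cast_zero]
  have hqf : ∀ ζ, zeroOrder q ζ ≤ zeroOrder f ζ := fun ζ => by
    by_cases h : zeroOrder f ζ ≤ n
    · rw [hq1 ζ h]
    · rw [hq2 ζ h]
      exact zero_le
  have hq0 : q ≠ 0 := by
    refine ne_zero_of_zeroOrder_ne_top hD (ζ := ⟨_, hDc.nonempty.some_mem⟩) ?_
    rw [hq]
    exact ENat.natCast_ne_top _
  obtain ⟨d, rfl⟩ := dvd_of_zeroOrder_le hD hDc.isPreconnected hq0 hqf
  refine ⟨q, d, rfl, fun hdM => hf ?_, fun ζ => ?_⟩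
  · have hd0 : d ≠ 0 := right_ne_zero_of_mul hf0
    obtain ⟨g, hg⟩ := exists_simple_zeros hD hDc.isPreconnected hd0 fun _ => True
    have hgM : g ∈ M := hM.mem_of_zeros_subset hD hDc hdM fun ζ hζ => by
      rw [← zeroOrder_ne_zero hD, hg]
      simp [hζ]
    have hg0 : g ^ n ≠ 0 := by
      refine ne_zero_of_zeroOrder_ne_top hD (ζ := ⟨_, hDc.nonempty.some_mem⟩) ?_
      rw [zeroOrder_pow hD, hg]
      split_ifs <;> simp
    have hgd : g ^ n ∣ d := dvd_of_zeroOrder_le hD hDc.isPreconnected hg0 fun ζ => by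
      rw [zeroOrder_pow hD, hg]
      by_cases hζ : d.1 ζ = 0
      · have h1 : ¬ zeroOrder (q * d) ζ ≤ n := fun h => by
          have h2 := hq1 ζ h
          rw [zeroOrder_mul hD] at h2
          have h3 : zeroOrder q ζ + 0 = zeroOrder q ζ + zeroOrder d ζ := by rw [add_zero]; exact h2
          have h4 : zeroOrder q ζ ≠ ⊤ := by rw [hq]; exact ENat.natCast_ne_top _
          exact (zeroOrder_ne_zero hD).mpr hζ ((ENat.addLECancellable_of_ne_top h4).inj.mp h3).symm
        have h2 := hq2 ζ h1
        rw [zeroOrder_mul hD, h2, zero_add, not_le] at h1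
        simpa [hζ] using h1.le
      · simp [hζ]
    exact Ideal.mul_mem_left _ _ (Ideal.mem_of_dvd _ hgd (Ideal.pow_mem_pow hgM n))
  · by_cases h : zeroOrder (q * d) ζ ≤ n
    · rw [hq1 ζ h]
      exact h
    · rw [hq2 ζ h]
      exact zero_le

theorem mem_krullIntersection {R : Type*} [CommRing R] {I : Ideal R} {x : R} :
    x ∈ krullIntersection I ↔ ∀ n, x ∈ I ^ n := by
  simp only [krullIntersection, Submodule.mem_iInf]
  refine ⟨fun h n => ?_, fun h n _ => h n⟩
  rcases n.eq_zero_or_pos with rfl | hn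
  · simp
  · exact h n hn

theorem krullIntersection_le {R : Type*} [CommRing R] (I : Ideal R) : krullIntersection I ≤ I :=
  fun x hx => by simpa using mem_krullIntersection.mp hx 1

theorem Ideal.IsMaximal.mem_pow_of_mul_mem_pow {R : Type*} [CommRing R] {M : Ideal R}
    (hM : M.IsMaximal) {q d : R} {n : ℕ} (hd : d ∉ M) (h : q * d ∈ M ^ n) : q ∈ M ^ n := by
  obtain ⟨y, i, hi, hyi⟩ := hM.exists_inv hd
  obtain ⟨u, v, huv⟩ := IsCoprime.pow_right (n := n) (⟨y, 1, by rw [one_mul, hyi]⟩ : IsCoprime d i)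
  have : q = u * (q * d) + q * v * i ^ n := by linear_combination -q * huv
  rw [this]
  exact (M ^ n).add_mem (Ideal.mul_mem_left _ _ h)
    (Ideal.mul_mem_left _ _ (Ideal.pow_mem_pow hi n))

theorem Ideal.IsMaximal.supZeroOrder_eq_top (hD : IsOpen D) (hDc : IsConnected D)
    {M : Ideal (holomorphicAlgebra D)} (hM : M.IsMaximal) {q d : holomorphicAlgebra D}
    (hd : d ∉ M) (h : q * d ∈ krullIntersection M) : supZeroOrder q = ⊤ := by
  refine ENat.eq_top_iff_forall_ge.mpr fun n => ?_
  obtain ⟨a, ha, b, rfl⟩ := Ideal.exists_pow_dvd_of_mem_pow hD hDc n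
    (hM.mem_pow_of_mul_mem_pow hd (mem_krullIntersection.mp h n))
  obtain ⟨ζ, hζ, -⟩ := Ideal.exists_common_zero hD hDc hM.ne_top ha ha
  refine le_trans ?_ (zeroOrder_le_supZeroOrder hD _ ζ)
  rw [zeroOrder_mul hD, zeroOrder_pow hD]
  refine le_add_right (le_mul_of_one_le_right (zero_le) ?_)
  exact Order.one_le_iff_ne_zero.mpr ((zeroOrder_ne_zero hD).mpr hζ)

theorem Ideal.IsMaximal.exists_factorization_of_notMem_krullIntersection (hD : IsOpen D)
    (hDc : IsConnected D) {M : Ideal (holomorphicAlgebra D)} (hM : M.IsMaximal)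
    {f : holomorphicAlgebra D} (hf : f ∉ krullIntersection M) :
    ∃ (n : ℕ) (q d : holomorphicAlgebra D), f = q * d ∧ d ∉ M ∧ ∀ ζ, zeroOrder q ζ ≤ n := by
  rw [mem_krullIntersection, not_forall] at hf
  obtain ⟨n, hn⟩ := hf
  exact ⟨n, hM.exists_factorization_of_notMem_pow hD hDc hn⟩

theorem Ideal.IsMaximal.isPrime_krullIntersection (hD : IsOpen D) (hDc : IsConnected D)
    {M : Ideal (holomorphicAlgebra D)} (hM : M.IsMaximal) : (krullIntersection M).IsPrime := by
  refine ⟨fun h => hM.ne_top (top_le_iff.mp (h ▸ krullIntersection_le M)), ?_⟩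
  intro f g hfg
  by_contra! h
  obtain ⟨n, q, d, rfl, hd, hq⟩ := hM.exists_factorization_of_notMem_krullIntersection hD hDc h.1
  obtain ⟨n', q', d', rfl, hd', hq'⟩ :=
    hM.exists_factorization_of_notMem_krullIntersection hD hDc h.2
  rw [mul_mul_mul_comm] at hfg
  refine supZeroOrder_ne_top hD hDc.nonempty (n := n + n') (fun ζ => ?_)
    (hM.supZeroOrder_eq_top hD hDc (fun hdd => (hM.isPrime.mem_or_mem hdd).elim hd hd') hfg)
  rw [zeroOrder_mul hD, Nat.cast_add]
  exact add_le_add (hq ζ) (hq' ζ)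

theorem IsFreeIdeal.exists_mem_ne_zero (hDne : D.Nonempty) {I : Ideal (holomorphicAlgebra D)}
    (hI : IsFreeIdeal I) : ∃ f ∈ I, f ≠ 0 := by
  by_contra! h
  have : (⟨_, hDne.some_mem⟩ : D) ∈ ⋂ f ∈ I, holomorphicZeros f :=
    Set.mem_iInter₂.mpr fun f hf => by rw [h f hf]; rfl
  rw [hI] at this
  exact this

theorem Ideal.IsMaximal.krullIntersection_ne (hD : IsOpen D) (hDc : IsConnected D)
    {M : Ideal (holomorphicAlgebra D)} (hM : M.IsMaximal) (hMfree : IsFreeIdeal M) :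
    krullIntersection M ≠ M := by
  classical
  intro h
  obtain ⟨f, hf, hf0⟩ := hMfree.exists_mem_ne_zero hDc.nonempty
  obtain ⟨g, hg⟩ := exists_simple_zeros hD hDc.isPreconnected hf0 fun _ => True
  have hgM : g ∈ M := hM.mem_of_zeros_subset hD hDc hf fun ζ hζ => by
    rw [← zeroOrder_ne_zero hD, hg]
    simp [hζ]
  rw [← h, ← mul_one g] at hgM
  refine supZeroOrder_ne_top hD hDc.nonempty (n := 1) (fun ζ => ?_)
    (hM.supZeroOrder_eq_top hD hDc ((Ideal.ne_top_iff_one M).mp hM.ne_top) hgM)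
  rw [hg]
  split_ifs <;> simp

theorem Ideal.IsPrime.le_krullIntersection (hD : IsOpen D) (hDc : IsConnected D)
    {M P : Ideal (holomorphicAlgebra D)} (hM : M.IsMaximal) (hP : P.IsPrime) (hPM : P ≤ M)
    (hPmax : ¬ P.IsMaximal) : P ≤ krullIntersection M := by
  classical
  intro f hf
  by_contra hfk
  obtain ⟨n, q, d, rfl, hd, hq⟩ := hM.exists_factorization_of_notMem_krullIntersection hD hDc hfk
  have hqP : q ∈ P := (hP.mem_or_mem hf).resolve_right fun h => hd (hPM h)
  have hqt : ∀ ζ, zeroOrder q ζ ≠ ⊤ := fun ζ => ne_top_of_le_ne_top (ENat.natCast_ne_top n) (hq ζ)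
  have hζ₀ := hDc.nonempty.some_mem
  have hq0 : q ≠ 0 := ne_zero_of_zeroOrder_ne_top hD (hqt ⟨_, hζ₀⟩)
  obtain ⟨g, hg⟩ := exists_simple_zeros hD hDc.isPreconnected hq0 fun _ => True
  have hgP : g ∈ P := by
    refine hP.mem_of_pow_mem n (P.mem_of_dvd ?_ hqP)
    refine dvd_of_zeroOrder_le hD hDc.isPreconnected hq0 fun ζ => ?_
    rw [zeroOrder_pow hD, hg]
    by_cases hζ : q.1 ζ = 0
    · simpa [hζ] using hq ζ
    · have : zeroOrder q ζ = 0 := by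
        by_contra h
        exact hζ ((zeroOrder_ne_zero hD).mp h)
      simp [this]
  refine hPmax ?_
  suffices M ≤ P from le_antisymm hPM this ▸ hM
  intro h hh
  obtain ⟨k, hk⟩ := exists_simple_zeros hD hDc.isPreconnected hq0 fun ζ => h.1 ζ = 0
  have hk0 : k ≠ 0 := by
    refine ne_zero_of_zeroOrder_ne_top hD (ζ := ⟨_, hζ₀⟩) ?_
    rw [hk]
    split_ifs <;> simp
  obtain ⟨l, rfl⟩ : k ∣ g := dvd_of_zeroOrder_le hD hDc.isPreconnected hk0 fun ζ => by
    rw [hg, hk]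
    by_cases h1 : q.1 ζ = 0 <;> by_cases h2 : h.1 ζ = 0 <;> simp [h1, h2]
  have hkh : k ∣ h := dvd_of_zeroOrder_le hD hDc.isPreconnected hk0 fun ζ => by
    rw [hk]
    split_ifs with h1
    · exact Order.one_le_iff_ne_zero.mpr ((zeroOrder_ne_zero hD).mpr h1.2)
    · exact zero_le
  refine P.mem_of_dvd hkh ((hP.mem_or_mem hgP).resolve_right fun hl => ?_)
  obtain ⟨ζ, h1, h2⟩ := Ideal.exists_common_zero hD hDc hM.ne_top (hPM hl) hh
  have h3 := hg ζ
  rw [zeroOrder_mul hD, hk] at h3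
  have h4 := (zeroOrder_ne_zero hD).mpr h1
  by_cases h5 : q.1 ζ = 0
  · simp only [h5, h2, and_self, if_true] at h3
    have h6 : (1 : ℕ∞) + zeroOrder l ζ = 1 + 0 := by rw [add_zero]; exact h3
    exact h4 ((ENat.addLECancellable_of_ne_top ENat.one_ne_top).inj.mp h6)
  · simp [h5] at h3
    exact h4 h3

end HolomorphicAlgebra

theorem mainTheorem3 (D : Set ℂ) (hDopen : IsOpen D) (hDconn : IsPathConnected D)
    (M : Ideal (holomorphicAlgebra D)) (hMmax : M.IsMaximal) (hMfree : IsFreeIdeal M) :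
    (krullIntersection M : Set (holomorphicAlgebra D)) =
        {f | f ∈ M ∧ ∀ d q : holomorphicAlgebra D, d ∉ M → f = q * d → supZeroOrder q = ⊤} ∧
      IsGreatest {P : Ideal (holomorphicAlgebra D) | P.IsPrime ∧ ¬ P.IsMaximal ∧ P ≤ M}
        (krullIntersection M) := by
  have hDc : IsConnected D := hDconn.isConnected
  refine ⟨Set.ext fun f => ⟨fun hf => ⟨krullIntersection_le M hf, ?_⟩, fun hf => ?_⟩,
    ⟨hMmax.isPrime_krullIntersection hDopen hDc, fun hmax => ?_, krullIntersection_le M⟩, ?_⟩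
  · rintro d q hd rfl
    exact hMmax.supZeroOrder_eq_top hDopen hDc hd hf
  · by_contra hfk
    obtain ⟨n, q, d, hfqd, hd, hq⟩ :=
      hMmax.exists_factorization_of_notMem_krullIntersection hDopen hDc hfk
    exact supZeroOrder_ne_top hDopen hDc.nonempty hq (hf.2 d q hd hfqd)
  · exact hMmax.krullIntersection_ne hDopen hDc hMfree
      (hmax.eq_of_le hMmax.ne_top (krullIntersection_le M))
  · rintro P ⟨hP, hPmax, hPM⟩
    exact hP.le_krullIntersection hDopen hDc hMmax hPM hPmax
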